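/- Let $\mathbb N=\{0,1,2,\dots\}$ and let $\mathbb N^\times=\mathbb N\setminus\{0\}$, regarded as a multiplicative semigroup. For $R\in\{\mathbb N,\mathbb Z\}$ let $R\rtimes\mathbb N^\times$ be the set $R\times\mathbb N^\times$ with the product $(m,k)(n,l)=(m+kn,kl)$. For $M=R\rtimes\mathbb N^\times$ let $(\delta_y)_{y\in M}$ be the canonical orthonormal basis of $\ell^2(M)$, let $T^M_x$ ($x\in M$) be the isometry of $\ell^2(M)$ with $T^M_x\delta_y=\delta_{xy}$ for all $y\in M$, and let $\mathcal T(M)\subset B(\ell^2(M))$ be the C$^*$-subalgebra generated by $\{T^M_x : x\in M\}$. Put $s=T^{\mathbb N\rtimes\mathbb N^\times}_{(1,1)}$, and let $\langle 1-ss^*\rangle$ be the closed two-sided ideal of $\mathcal T(\mathbb N\rtimes\mathbb N^\times)$ generated by $1-ss^*$. Then the representation $x\mapsto T^{\mathbb Z\rtimes\mathbb N^\times}_x$ of $\mathbb N\rtimes\mathbb N^\times\subset\mathbb Z\rtimes\mathbb N^\times$ by isometries on $\ell^2(\mathbb Z\rtimes\mathbb N^\times)$ induces an isomorphism $$\mathcal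 T(\mathbb N\rtimes\mathbb N^\times)/\langle 1-ss^*\rangle\;\cong\;\mathcal T(\mathbb Z\rtimes\mathbb N^\times).$$ That is, there is a $*$-isomorphism $\Phi$ from the quotient $\mathcal T(\mathbb N\rtimes\mathbb N^\times)/\langle 1-ss^*\rangle$ onto $\mathcal T(\mathbb Z\rtimes\mathbb N^\times)$ which is isometric for the quotient norm and satisfies $\Phi\bigl(T^{\mathbb N\rtimes\mathbb N^\times}_x+\langle 1-ss^*\rangle\bigr)=T^{\mathbb Z\rtimes\mathbb N^\times}_x$ for every $x\in\mathbb N\rtimes\mathbb N^\times$, and $\Phi$ is the only unital $*$-homomorphism from the quotient to $\mathcal T(\mathbb Z\rtimes\mathbb N^\times)$ with this property. -/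

import Mathlib

/-- The affine semigroup `R ⋊ ℕ^×` of a semiring `R` (used for `R = ℕ` and `R = ℤ`), where
`ℕ^× = ℕ+` acts on `(R, +)` by multiplication.  An element is a pair `(add, mul)`. -/
@[ext]
structure AffineSemigroup (R : Type*) where
  /-- the additive part -/
  add : R
  /-- the multiplicative part -/
  mul : ℕ+

namespace AffineSemigroup

/-- `(m, k) (n, l) = (m + k n, k l)`, with identity `(0, 1)`. -/
instance instMonoid {R : Type*} [Semiring R] : Monoid (AffineSemigroup R) where
  mul x y := ⟨x.add + ((x.mul : ℕ) : R) * y.add, x.mul * y.mul⟩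
  one := ⟨0, 1⟩
  mul_assoc x y z := by
    change AffineSemigroup.mk _ _ = AffineSemigroup.mk _ _
    congr 1
    · change x.add + ((x.mul : ℕ) : R) * y.add + (((x.mul * y.mul : ℕ+) : ℕ) : R) * z.add =
        x.add + ((x.mul : ℕ) : R) * (y.add + ((y.mul : ℕ) : R) * z.add)
      rw [PNat.mul_coe, Nat.cast_mul, mul_add, mul_assoc, add_assoc]
    · exact mul_assoc _ _ _
  one_mul x := by
    change AffineSemigroup.mk (0 + (((1 : ℕ+) : ℕ) : R) * x.add) (1 * x.mul) = x
    simp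
  mul_one x := by
    change AffineSemigroup.mk (x.add + ((x.mul : ℕ) : R) * 0) (x.mul * 1) = x
    simp

theorem mul_def {R : Type*} [Semiring R] (x y : AffineSemigroup R) :
    x * y = ⟨x.add + ((x.mul : ℕ) : R) * y.add, x.mul * y.mul⟩ := rfl

instance instIsLeftCancelMul {R : Type*} [Semiring R] [IsLeftCancelAdd R] [CharZero R]
    [IsLeftCancelMulZero R] : IsLeftCancelMul (AffineSemigroup R) where
  mul_left_cancel x y z h := by
    simp only [mul_def, AffineSemigroup.mk.injEq] at h
    have hk : ((x.mul : ℕ) : R) ≠ 0 := Nat.cast_ne_zero.mpr x.mul.ne_zero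
    exact AffineSemigroup.ext (mul_left_cancel₀ hk (add_left_cancel h.1)) (mul_left_cancel h.2)

/-- The inclusion `ℕ ⋊ ℕ^× ⊆ ℤ ⋊ ℕ^×`. -/
def inclusion : AffineSemigroup ℕ →* AffineSemigroup ℤ where
  toFun x := ⟨(x.add : ℤ), x.mul⟩
  map_one' := rfl
  map_mul' x y := by
    simp only [mul_def]
    congr 1

end AffineSemigroup

noncomputable section

/-- The Hilbert space `ℓ²(M)` of square summable complex functions on `M`. -/
abbrev ellTwo (M : Type*) : Type _ := lp (fun _ : M => ℂ) 2

open Classical in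
/-- The canonical basis vector `δ_y` of `ℓ²(M)`. -/
def delta {M : Type*} (y : M) : ellTwo M := lp.single 2 y (1 : ℂ)

theorem orthonormal_delta_mul {M : Type*} [Monoid M] [IsLeftCancelMul M] (x : M) :
    Orthonormal ℂ (fun y : M => delta (x * y)) := by
  classical
  rw [orthonormal_iff_ite]
  intro y z
  simp only [delta]
  rw [lp.inner_single_left, lp.single_apply]
  by_cases h : y = z
  · subst h; simp
  · have h' : x * y ≠ x * z := fun e => h (mul_left_cancel e)
    simp [h, h']

/-- For a left cancellative monoid `M` and `x ∈ M`, the isometry `T_x` of `ℓ²(M)` determined by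
`T_x δ_y = δ_{xy}`. -/
def toeplitzIsometry {M : Type*} [Monoid M] [IsLeftCancelMul M] (x : M) :
    ellTwo M →ₗᵢ[ℂ] ellTwo M :=
  (orthonormal_delta_mul x).orthogonalFamily.linearIsometry

/-- `T_x` as an element of `B(ℓ²(M))`. -/
def toeplitzOp {M : Type*} [Monoid M] [IsLeftCancelMul M] (x : M) : ellTwo M →L[ℂ] ellTwo M :=
  (toeplitzIsometry x).toContinuousLinearMap

theorem toeplitzOp_delta {M : Type*} [Monoid M] [IsLeftCancelMul M] (x y : M) :
    toeplitzOp x (delta y) = delta (x * y) := by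
  classical
  change (orthonormal_delta_mul x).orthogonalFamily.linearIsometry _ = _
  have h : (delta y : ellTwo M) = lp.single 2 y (1 : ℂ) := by
    simp only [delta]
  rw [h, OrthogonalFamily.linearIsometry_apply_single]
  simp

/-- The Toeplitz algebra `𝒯(M)`: the (norm closed) C⋆-subalgebra of `B(ℓ²(M))` generated by the
operators `T_x`, `x ∈ M`. -/
def toeplitzAlgebra (M : Type*) [Monoid M] [IsLeftCancelMul M] :
    StarSubalgebra ℂ (ellTwo M →L[ℂ] ellTwo M) :=
  (StarAlgebra.adjoin ℂ (Set.range (toeplitzOp : M → (ellTwo M →L[ℂ] ellTwo M)))).topologicalClosure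

/-- The generator `T_x` as an element of `𝒯(M)`. -/
def toeplitzGen {M : Type*} [Monoid M] [IsLeftCancelMul M] (x : M) : toeplitzAlgebra M :=
  ⟨toeplitzOp x, StarSubalgebra.le_topologicalClosure _
    (StarAlgebra.subset_adjoin ℂ _ (Set.mem_range_self x))⟩

/-- The closed two-sided ideal `⟨X⟩` generated by a subset `X` of a topological ring. -/
def closedIdeal {A : Type*} [Ring A] [TopologicalSpace A] [IsTopologicalRing A] (X : Set A) :
    Ideal A :=
  (TwoSidedIdeal.span X).asIdeal.closure

theorem coe_closedIdeal {A : Type*} [Ring A] [TopologicalSpace A] [IsTopologicalRing A]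
    (X : Set A) : (closedIdeal X : Set A) = closure (TwoSidedIdeal.span X : Set A) := rfl

instance closedIdeal_isTwoSided {A : Type*} [Ring A] [TopologicalSpace A] [IsTopologicalRing A]
    (X : Set A) : (closedIdeal X).IsTwoSided where
  mul_mem_of_left {a} b ha := by
    have ha' : a ∈ closure (TwoSidedIdeal.span X : Set A) := ha
    exact map_mem_closure (f := fun x => x * b) (continuous_mul_const b) ha'
      fun y hy => (TwoSidedIdeal.span X).mul_mem_right y b hy

theorem star_mem_closedIdeal {A : Type*} [Ring A] [StarRing A] [TopologicalSpace A]
    [IsTopologicalRing A] [ContinuousStar A] {X : Set A} (hX : ∀ x ∈ X, star x = x)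
    {a : A} (ha : a ∈ closedIdeal X) : star a ∈ closedIdeal X := by
  have ha' : a ∈ closure (TwoSidedIdeal.span X : Set A) := ha
  refine map_mem_closure continuous_star ha' fun y hy => ?_
  have hy' : y ∈ TwoSidedIdeal.span X := hy
  change star y ∈ TwoSidedIdeal.span X
  clear hy
  induction hy' using TwoSidedIdeal.span_induction with
  | mem x h => rw [hX x h]; exact TwoSidedIdeal.subset_span h
  | zero => rw [star_zero]; exact zero_mem _
  | add x y hx hy h₁ h₂ => rw [star_add]; exact add_mem h₁ h₂
  | neg x hx h => rw [star_neg]; exact neg_mem h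
  | left_absorb b x hx h => rw [star_mul]; exact TwoSidedIdeal.mul_mem_right _ _ _ h
  | right_absorb b x hx h => rw [star_mul]; exact TwoSidedIdeal.mul_mem_left _ _ _ h

/-- The isometry `s = T_{(1,1)}` in `𝒯(ℕ ⋊ ℕ^×)`. -/
def sGen : toeplitzAlgebra (AffineSemigroup ℕ) := toeplitzGen ⟨1, 1⟩

/-- The closed two-sided ideal `⟨1 - s s⋆⟩` of `𝒯(ℕ ⋊ ℕ^×)`. -/
def boundaryIdeal : Ideal (toeplitzAlgebra (AffineSemigroup ℕ)) :=
  closedIdeal {1 - sGen * star sGen}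

instance boundaryIdeal_isTwoSided : boundaryIdeal.IsTwoSided := closedIdeal_isTwoSided _

instance boundaryIdeal_isClosed :
    IsClosed (boundaryIdeal : Set (toeplitzAlgebra (AffineSemigroup ℕ))) := by
  unfold boundaryIdeal
  rw [coe_closedIdeal]
  exact isClosed_closure

theorem star_mem_boundaryIdeal {a : toeplitzAlgebra (AffineSemigroup ℕ)}
    (ha : a ∈ boundaryIdeal) : star a ∈ boundaryIdeal := by
  refine star_mem_closedIdeal ?_ ha
  rintro x rfl
  simp

/-- The quotient algebra `𝒯(ℕ ⋊ ℕ^×) / ⟨1 - s s⋆⟩`. -/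
abbrev BoundaryQuotient : Type := toeplitzAlgebra (AffineSemigroup ℕ) ⧸ boundaryIdeal

/-- The quotient map `𝒯(ℕ ⋊ ℕ^×) → 𝒯(ℕ ⋊ ℕ^×) / ⟨1 - s s⋆⟩`. -/
def boundaryMk : toeplitzAlgebra (AffineSemigroup ℕ) →ₐ[ℂ] BoundaryQuotient :=
  Ideal.Quotient.mkₐ ℂ boundaryIdeal

theorem boundaryMk_surjective : Function.Surjective boundaryMk :=
  Ideal.Quotient.mk_surjective

theorem boundaryMk_eq_iff {a b : toeplitzAlgebra (AffineSemigroup ℕ)} :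
    boundaryMk a = boundaryMk b ↔ a - b ∈ boundaryIdeal :=
  Ideal.Quotient.mk_eq_mk_iff_sub_mem a b

/-- The involution of the quotient: `[a]⋆ = [a⋆]`. -/
instance BoundaryQuotient.instStar : Star BoundaryQuotient where
  star := Quotient.lift (fun a => boundaryMk (star a)) (by
    intro a b hab
    have h : boundaryMk a = boundaryMk b := Quotient.sound hab
    rw [boundaryMk_eq_iff] at h ⊢
    rw [← star_sub]
    exact star_mem_boundaryIdeal h)

theorem star_boundaryMk (a : toeplitzAlgebra (AffineSemigroup ℕ)) :
    star (boundaryMk a) = boundaryMk (star a) := rfl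

instance BoundaryQuotient.instStarRing : StarRing BoundaryQuotient where
  star_involutive x := by
    obtain ⟨a, rfl⟩ := boundaryMk_surjective x
    simp only [star_boundaryMk, star_star]
  star_mul x y := by
    obtain ⟨a, rfl⟩ := boundaryMk_surjective x
    obtain ⟨b, rfl⟩ := boundaryMk_surjective y
    rw [← map_mul, star_boundaryMk, star_boundaryMk, star_boundaryMk, star_mul, map_mul]
  star_add x y := by
    obtain ⟨a, rfl⟩ := boundaryMk_surjective x
    obtain ⟨b, rfl⟩ := boundaryMk_surjective y
    rw [← map_add, star_boundaryMk, star_boundaryMk, star_boundaryMk, star_add, map_add]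

instance BoundaryQuotient.instStarModule : StarModule ℂ BoundaryQuotient where
  star_smul c x := by
    obtain ⟨a, rfl⟩ := boundaryMk_surjective x
    rw [← map_smul, star_boundaryMk, star_boundaryMk, star_smul, map_smul]

/-- The quotient norm. -/
instance BoundaryQuotient.instNorm : Norm BoundaryQuotient :=
  (Submodule.Quotient.normedAddCommGroup boundaryIdeal).toNorm

/-- The quotient norm of `[a]` is the distance from `a` to the ideal. -/
theorem BoundaryQuotient.norm_mk (a : toeplitzAlgebra (AffineSemigroup ℕ)) :
    ‖boundaryMk a‖ = Metric.infDist a (boundaryIdeal : Set _) :=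
  QuotientAddGroup.norm_mk (S := boundaryIdeal.toAddSubgroup) a

end

/-! Right multiplication by $(-j,1)$ commutes with left multiplication, so
$V_j:\delta_z\mapsto\delta_{z(-j,1)}$ intertwines $T_x$ on $\ell^2(\mathbb N\rtimes\mathbb
N^\times)$ with $T_x$ on $\ell^2(\mathbb Z\rtimes\mathbb N^\times)$. It intertwines $T_x^*$ only on
$\delta_z$ with large additive part, with a bound independent of $j$. Hence if $a$ and $b$ are the
same polynomial in the $T_x$, $T_x^*$ on the two spaces, then $V_ja=bV_j$ on a tail.

Two estimates follow. Every finitely supported vector is $V_j$ of a tail vector for large $j$, so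
$\|b\|\le\|a\|$. Since $s$ is unitary modulo the ideal, $\|[a]\|\le\|as^N\|$; as $s^N$ maps into the
tail, $\|as^N\|\le\|b\|$.

Both pass to the closed algebra of pairs $(a,b)$ (`norm_le_of_mem_pairAlgebra`). It is therefore the
graph of a representation `toeplitzRep`, which kills $1-ss^*$ because $(1,1)$ is invertible in
$\mathbb Z\rtimes\mathbb N^\times$. So its norm is exactly the quotient norm (`norm_toeplitzRep`).
-/

theorem delta_apply {X : Type*} [DecidableEq X] (x y : X) :
    (delta x : ellTwo X) y = if y = x then 1 else 0 := by
  by_cases h : y = x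
  · subst h; simp [delta]
  · simp [delta, h]

theorem inner_delta_left {X : Type*} (x : X) (ξ : ellTwo X) : inner ℂ (delta x) ξ = ξ x := by
  classical
  rw [delta, lp.inner_single_left]
  simp

theorem orthonormal_delta_comp {X Y : Type*} {f : X → Y} (hf : Function.Injective f) :
    Orthonormal ℂ (fun x => (delta (f x) : ellTwo Y)) := by
  classical
  rw [orthonormal_iff_ite]
  intro x y
  rw [inner_delta_left, delta_apply]
  simp [hf.eq_iff]

/-- The isometry `ℓ²(X) → ℓ²(Y)`, `δ_x ↦ δ_{f x}`, of an injective map `f : X → Y`. -/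
noncomputable def ellTwoMap {X Y : Type*} {f : X → Y} (hf : Function.Injective f) :
    ellTwo X →ₗᵢ[ℂ] ellTwo Y :=
  (orthonormal_delta_comp hf).orthogonalFamily.linearIsometry

theorem ellTwoMap_delta {X Y : Type*} {f : X → Y} (hf : Function.Injective f) (x : X) :
    ellTwoMap hf (delta x) = delta (f x) := by
  classical
  have h : (delta x : ellTwo X) = lp.single 2 x (1 : ℂ) := by
    simp only [delta]
  rw [h, ellTwoMap, OrthogonalFamily.linearIsometry_apply_single]
  simp

theorem topologicalClosure_span_delta (X : Type*) :
    (Submodule.span ℂ (Set.range (delta : X → ellTwo X))).topologicalClosure = ⊤ := by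
  rw [Submodule.topologicalClosure_eq_top_iff, Submodule.eq_bot_iff]
  intro ξ hξ
  ext x
  rw [← inner_delta_left, (Submodule.mem_orthogonal _ ξ).1 hξ _ (Submodule.subset_span ⟨x, rfl⟩)]
  rfl

theorem opNorm_le_of_span_delta {X F : Type*} [NormedAddCommGroup F] [NormedSpace ℂ F]
    (a : ellTwo X →L[ℂ] F) {C : ℝ} (hC : 0 ≤ C)
    (h : ∀ ξ ∈ Submodule.span ℂ (Set.range (delta : X → ellTwo X)), ‖a ξ‖ ≤ C * ‖ξ‖) :
    ‖a‖ ≤ C := by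
  refine a.opNorm_le_bound hC fun ξ => ?_
  have hξ : ξ ∈ (Submodule.span ℂ (Set.range (delta : X → ellTwo X))).topologicalClosure := by
    rw [topologicalClosure_span_delta]; trivial
  have hcl : IsClosed {ξ : ellTwo X | ‖a ξ‖ ≤ C * ‖ξ‖} :=
    isClosed_le (by fun_prop) (by fun_prop)
  exact closure_minimal h hcl hξ

/-! ### Toeplitz operators and homomorphisms of Toeplitz algebras -/

theorem norm_toeplitzOp_apply {M : Type*} [Monoid M] [IsLeftCancelMul M] (x : M) (ξ : ellTwo M) :
    ‖toeplitzOp x ξ‖ = ‖ξ‖ :=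
  (toeplitzIsometry x).norm_map ξ

theorem star_toeplitzOp_delta_apply {M : Type*} [Monoid M] [IsLeftCancelMul M] [DecidableEq M]
    (x w z : M) : star (toeplitzOp x) (delta w) z = if x * z = w then 1 else 0 := by
  rw [← inner_delta_left, ContinuousLinearMap.star_eq_adjoint,
    ContinuousLinearMap.adjoint_inner_right, toeplitzOp_delta, inner_delta_left, delta_apply]

theorem star_toeplitzOp_delta_mul {M : Type*} [Monoid M] [IsLeftCancelMul M] (x y : M) :
    star (toeplitzOp x) (delta (x * y)) = delta y := by
  classical
  ext z
  rw [star_toeplitzOp_delta_apply, delta_apply]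
  simp

theorem star_toeplitzOp_delta_eq_zero {M : Type*} [Monoid M] [IsLeftCancelMul M] {x w : M}
    (h : ∀ y, x * y ≠ w) : star (toeplitzOp x) (delta w) = 0 := by
  classical
  ext z
  rw [star_toeplitzOp_delta_apply, if_neg (h z)]
  rfl

theorem isometry_toeplitzGen {M : Type*} [Monoid M] [IsLeftCancelMul M] (x : M) :
    star (toeplitzGen x) * toeplitzGen x = 1 := by
  apply Subtype.ext
  change star (toeplitzOp x) * toeplitzOp x = 1
  rw [ContinuousLinearMap.star_eq_adjoint]
  exact (ContinuousLinearMap.norm_map_iff_adjoint_comp_self _).1 (norm_toeplitzOp_apply x)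

theorem toeplitzGen_mul {M : Type*} [Monoid M] [IsLeftCancelMul M] (x y : M) :
    toeplitzGen (x * y) = toeplitzGen x * toeplitzGen y := by
  apply Subtype.ext
  change toeplitzOp (x * y) = toeplitzOp x * toeplitzOp y
  rw [← sub_eq_zero, ← norm_le_zero_iff]
  refine opNorm_le_of_span_delta _ le_rfl fun ξ hξ => ?_
  rw [zero_mul, norm_le_zero_iff]
  have h : Submodule.span ℂ (Set.range (delta : M → ellTwo M)) ≤
      LinearMap.ker (toeplitzOp (x * y) - toeplitzOp x * toeplitzOp y).toLinearMap := by
    rw [Submodule.span_le]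
    rintro _ ⟨z, rfl⟩
    simp [toeplitzOp_delta, mul_assoc]
  exact h hξ

instance isClosed_toeplitzAlgebra (M : Type*) [Monoid M] [IsLeftCancelMul M] :
    IsClosed (toeplitzAlgebra M : Set (ellTwo M →L[ℂ] ellTwo M)) :=
  StarSubalgebra.isClosed_topologicalClosure _

/-- A star homomorphism to `𝒯(M)` with closed range that hits every generator is onto. -/
theorem surjective_of_toeplitzGen_mem_range {M B : Type*} [Monoid M] [IsLeftCancelMul M]
    [Semiring B] [StarRing B] [Algebra ℂ B] [StarModule ℂ B] (φ : B →⋆ₐ[ℂ] toeplitzAlgebra M)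
    (hc : IsClosed (Set.range φ)) (h : ∀ x, toeplitzGen x ∈ Set.range φ) :
    Function.Surjective φ := by
  let K : StarSubalgebra ℂ (ellTwo M →L[ℂ] ellTwo M) := φ.range.map (toeplitzAlgebra M).subtype
  have hK : IsClosed (K : Set (ellTwo M →L[ℂ] ellTwo M)) :=
    (isClosed_toeplitzAlgebra M).isClosedEmbedding_subtypeVal.isClosedMap _ hc
  have hle : toeplitzAlgebra M ≤ K := by
    refine StarSubalgebra.topologicalClosure_minimal (StarAlgebra.adjoin_le ?_) hK
    rintro _ ⟨x, rfl⟩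
    exact ⟨toeplitzGen x, h x, rfl⟩
  intro a
  obtain ⟨b, hb, hba⟩ := hle a.2
  obtain ⟨c, rfl⟩ := hb
  exact ⟨c, Subtype.ext hba⟩

/-- Continuous star homomorphisms on `𝒯(M)` are determined by the images of the generators. -/
theorem toeplitzAlgebra_hom_ext {M B : Type*} [Monoid M] [IsLeftCancelMul M] [CStarAlgebra B]
    {φ ψ : toeplitzAlgebra M →⋆ₐ[ℂ] B} (h : ∀ x, φ (toeplitzGen x) = ψ (toeplitzGen x)) :
    φ = ψ := by
  have hφ : Continuous φ := AddMonoidHomClass.continuous_of_bound φ 1 fun a => by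
    simpa using NonUnitalStarAlgHom.norm_apply_le φ a
  have hψ : Continuous ψ := AddMonoidHomClass.continuous_of_bound ψ 1 fun a => by
    simpa using NonUnitalStarAlgHom.norm_apply_le ψ a
  refine StarAlgHom.ext_topologicalClosure hφ hψ ?_
  apply StarAlgHom.ext_adjoin
  rintro ⟨_, hx⟩ ⟨x, rfl⟩
  exact h x

/-! ### Shifted embeddings and asymptotic intertwining -/

open AffineSemigroup

/-- The map `z ↦ z (-j, 1)` from `ℕ ⋊ ℕ^×` to `ℤ ⋊ ℕ^×`. -/
def shiftedInclusion (j : ℕ) (z : AffineSemigroup ℕ) : AffineSemigroup ℤ :=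
  inclusion z * ⟨-(j : ℤ), 1⟩

theorem shiftedInclusion_injective (j : ℕ) : Function.Injective (shiftedInclusion j) := by
  rintro ⟨n, l⟩ ⟨m, k⟩ h
  simp only [shiftedInclusion, inclusion, mul_def, MonoidHom.coe_mk, OneHom.coe_mk,
    AffineSemigroup.mk.injEq, mul_one] at h
  obtain ⟨h₁, rfl⟩ := h
  simpa using h₁

theorem shiftedInclusion_mul (j : ℕ) (x z : AffineSemigroup ℕ) :
    shiftedInclusion j (x * z) = inclusion x * shiftedInclusion j z := by
  rw [shiftedInclusion, map_mul, mul_assoc, shiftedInclusion]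

/-- Far to the right, divisibility by `x` in `ℤ ⋊ ℕ^×` comes from `ℕ ⋊ ℕ^×`. -/
theorem exists_mul_eq_of_inclusion_mul_eq {j : ℕ} {x z : AffineSemigroup ℕ} {y : AffineSemigroup ℤ}
    (hz : x.add ≤ z.add) (h : inclusion x * y = shiftedInclusion j z) : ∃ w, x * w = z := by
  obtain ⟨m, k⟩ := x
  obtain ⟨n, l⟩ := z
  obtain ⟨q, r⟩ := y
  simp only [shiftedInclusion, inclusion, mul_def, MonoidHom.coe_mk, OneHom.coe_mk,
    AffineSemigroup.mk.injEq, mul_one] at h hz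
  obtain ⟨h₁, rfl⟩ := h
  have hk : (0 : ℤ) < ((k : ℕ) : ℤ) := by exact_mod_cast k.pos
  -- Comparing additive parts gives $m+kq=n-krj$; the candidate $w$ is $(q+rj,r)$, nonnegative
  -- because $m\le n$.
  have h₂ : ((k : ℕ) : ℤ) * (q + (r : ℕ) * j) = (n : ℤ) - m := by
    rw [PNat.mul_coe] at h₁
    push_cast at h₁ ⊢
    linarith
  have h₃ : 0 ≤ q + ((r : ℕ) : ℤ) * j := by
    refine nonneg_of_mul_nonneg_right (a := ((k : ℕ) : ℤ)) ?_ hk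
    rw [h₂]; omega
  obtain ⟨t, ht⟩ := Int.eq_ofNat_of_zero_le h₃
  refine ⟨⟨t, r⟩, ?_⟩
  simp only [mul_def, AffineSemigroup.mk.injEq, and_true, Nat.cast_id]
  rw [ht] at h₂
  zify
  linarith

/-- The isometry `ℓ²(ℕ ⋊ ℕ^×) → ℓ²(ℤ ⋊ ℕ^×)`, `δ_z ↦ δ_{z (-j, 1)}`. -/
noncomputable def shiftedEmbedding (j : ℕ) :
    ellTwo (AffineSemigroup ℕ) →ₗᵢ[ℂ] ellTwo (AffineSemigroup ℤ) :=
  ellTwoMap (shiftedInclusion_injective j)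

theorem shiftedEmbedding_delta (j : ℕ) (z : AffineSemigroup ℕ) :
    shiftedEmbedding j (delta z) = delta (shiftedInclusion j z) :=
  ellTwoMap_delta _ z

/-- The span of the basis vectors `δ_{(n, l)}` with `N ≤ n`. -/
noncomputable def tailSpan (N : ℕ) : Submodule ℂ (ellTwo (AffineSemigroup ℕ)) :=
  Submodule.span ℂ (delta '' {z | N ≤ z.add})

theorem delta_mem_tailSpan {N : ℕ} {z : AffineSemigroup ℕ} (h : N ≤ z.add) :
    delta z ∈ tailSpan N :=
  Submodule.subset_span ⟨z, h, rfl⟩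

theorem tailSpan_antitone : Antitone tailSpan := fun _ _ h =>
  Submodule.span_mono (Set.image_mono fun _ hz => h.trans hz)

/-- A pair intertwined by all the isometries `shiftedEmbedding j`, far enough to the right. -/
def AsymptoticallyIntertwined
    (t : toeplitzAlgebra (AffineSemigroup ℕ) × toeplitzAlgebra (AffineSemigroup ℤ)) : Prop :=
  ∀ N' : ℕ, ∃ N : ℕ, ∀ η ∈ tailSpan N, t.1.1 η ∈ tailSpan N' ∧
    ∀ j, shiftedEmbedding j (t.1.1 η) = t.2.1 (shiftedEmbedding j η)

theorem AsymptoticallyIntertwined.of_delta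
    {t : toeplitzAlgebra (AffineSemigroup ℕ) × toeplitzAlgebra (AffineSemigroup ℤ)}
    (h : ∀ N' : ℕ, ∃ N : ℕ, ∀ z : AffineSemigroup ℕ, N ≤ z.add →
      t.1.1 (delta z) ∈ tailSpan N' ∧
      ∀ j, shiftedEmbedding j (t.1.1 (delta z)) = t.2.1 (delta (shiftedInclusion j z))) :
    AsymptoticallyIntertwined t := by
  intro N'
  obtain ⟨N, hN⟩ := h N'
  refine ⟨N, fun η hη => ?_⟩
  induction hη using Submodule.span_induction with
  | mem η hη =>
    obtain ⟨z, hz, rfl⟩ := hη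
    simpa only [shiftedEmbedding_delta] using hN z hz
  | zero => simp
  | add η₁ η₂ _ _ h₁ h₂ =>
    refine ⟨?_, fun j => ?_⟩
    · rw [map_add]; exact add_mem h₁.1 h₂.1
    · simp only [map_add, h₁.2 j, h₂.2 j]
  | smul c η _ h₁ =>
    refine ⟨?_, fun j => ?_⟩
    · rw [map_smul]; exact Submodule.smul_mem _ c h₁.1
    · simp only [map_smul, h₁.2 j]

/-- Left multiplication by $x$ never lowers the additive part, so tails are preserved and $N=N'$
works. -/
theorem asymptoticallyIntertwined_gen (x : AffineSemigroup ℕ) :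
    AsymptoticallyIntertwined (toeplitzGen x, toeplitzGen (inclusion x)) := by
  refine .of_delta fun N' => ⟨N', fun z hz => ?_⟩
  change toeplitzOp x (delta z) ∈ _ ∧ ∀ j, shiftedEmbedding j (toeplitzOp x (delta z)) =
    toeplitzOp (inclusion x) (delta (shiftedInclusion j z))
  simp only [toeplitzOp_delta, shiftedEmbedding_delta, shiftedInclusion_mul, implies_true, and_true]
  refine delta_mem_tailSpan (hz.trans ?_)
  simp only [mul_def, Nat.cast_id]
  exact (Nat.le_mul_of_pos_left _ x.mul.pos).trans (Nat.le_add_left _ _)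

theorem asymptoticallyIntertwined_star_gen (x : AffineSemigroup ℕ) :
    AsymptoticallyIntertwined (star (toeplitzGen x), star (toeplitzGen (inclusion x))) := by
  -- If $z=xw$, this bound forces `w.add` to be at least $N'$; if $x$ does not divide $z$, it forces
  -- `z.add` to be at least `x.add`, so $x$ does not divide the image in $\mathbb Z\rtimes\mathbb
  -- N^\times$ either.
  refine .of_delta fun N' => ⟨x.add + x.mul * N', fun z hz => ?_⟩
  change star (toeplitzOp x) (delta z) ∈ _ ∧
    ∀ j, shiftedEmbedding j (star (toeplitzOp x) (delta z)) =
      star (toeplitzOp (inclusion x)) (delta (shiftedInclusion j z))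
  by_cases h : ∃ w, x * w = z
  · obtain ⟨w, rfl⟩ := h
    simp only [star_toeplitzOp_delta_mul, shiftedEmbedding_delta, shiftedInclusion_mul,
      implies_true, and_true]
    apply delta_mem_tailSpan
    simp only [mul_def, Nat.cast_id, add_le_add_iff_left] at hz
    exact Nat.le_of_mul_le_mul_left hz x.mul.pos
  · rw [star_toeplitzOp_delta_eq_zero fun y hy => h ⟨y, hy⟩]
    refine ⟨zero_mem _, fun j => ?_⟩
    rw [map_zero, star_toeplitzOp_delta_eq_zero fun y hy =>
      h (exists_mul_eq_of_inclusion_mul_eq (le_of_add_le_left hz) hy)]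

/-- The asymptotically intertwined pairs form an algebra. -/
noncomputable def asymptoticSubalgebra :
    Subalgebra ℂ (toeplitzAlgebra (AffineSemigroup ℕ) × toeplitzAlgebra (AffineSemigroup ℤ)) where
  carrier := {t | AsymptoticallyIntertwined t}
  -- The second factor must land in the tail where the first is intertwined; this is why the target
  -- tail $N'$ is prescribed.
  mul_mem' {t u} ht hu := fun N' => by
    obtain ⟨N₁, h₁⟩ := ht N'
    obtain ⟨N₂, h₂⟩ := hu N₁
    refine ⟨N₂, fun η hη => ⟨(h₁ _ (h₂ η hη).1).1, fun j => ?_⟩⟩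
    change shiftedEmbedding j (t.1.1 (u.1.1 η)) = t.2.1 (u.2.1 (shiftedEmbedding j η))
    rw [(h₁ _ (h₂ η hη).1).2 j, (h₂ η hη).2 j]
  add_mem' {t u} ht hu := fun N' => by
    obtain ⟨N₁, h₁⟩ := ht N'
    obtain ⟨N₂, h₂⟩ := hu N'
    refine ⟨max N₁ N₂, fun η hη => ?_⟩
    obtain ⟨h₃, h₄⟩ := h₁ η (tailSpan_antitone (le_max_left _ _) hη)
    obtain ⟨h₅, h₆⟩ := h₂ η (tailSpan_antitone (le_max_right _ _) hη)
    refine ⟨add_mem h₃ h₅, fun j => ?_⟩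
    change shiftedEmbedding j (t.1.1 η + u.1.1 η) =
      t.2.1 (shiftedEmbedding j η) + u.2.1 (shiftedEmbedding j η)
    rw [map_add, h₄ j, h₆ j]
  algebraMap_mem' c := fun N' => ⟨N', fun η hη => ⟨Submodule.smul_mem _ c hη, fun j =>
    (shiftedEmbedding j).map_smul c η⟩⟩

/-! ### The two norm estimates -/

/-- $\delta_{(n,l)}$ is the image of $\delta_{(n+lj,l)}$. Allowing all $j\ge J$ lets the summands of
a finite sum share one $j$. -/
theorem exists_shiftedEmbedding_eq (N : ℕ) {ξ : ellTwo (AffineSemigroup ℤ)}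
    (hξ : ξ ∈ Submodule.span ℂ (Set.range (delta : AffineSemigroup ℤ → _))) :
    ∃ J : ℕ, ∀ j, J ≤ j → ∃ η ∈ tailSpan N, shiftedEmbedding j η = ξ := by
  induction hξ using Submodule.span_induction with
  | mem ξ hξ =>
    obtain ⟨⟨n, l⟩, rfl⟩ := hξ
    -- Since $l\ge1$, $n+lj\ge n+j\ge N$.
    refine ⟨N + n.natAbs, fun j hj => ?_⟩
    have hl : (1 : ℤ) ≤ ((l : ℕ) : ℤ) := by exact_mod_cast l.pos
    have hjl : (j : ℤ) ≤ (l : ℕ) * j := le_mul_of_one_le_left (by positivity) hl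
    have h₀ : 0 ≤ n + (l : ℕ) * j := by omega
    obtain ⟨t, ht⟩ := Int.eq_ofNat_of_zero_le h₀
    refine ⟨delta ⟨t, l⟩, delta_mem_tailSpan (by simp only; omega), ?_⟩
    rw [shiftedEmbedding_delta]
    congr 1
    simp only [shiftedInclusion, inclusion, mul_def, MonoidHom.coe_mk, OneHom.coe_mk,
      AffineSemigroup.mk.injEq, mul_one, and_true]
    linarith
  | zero => exact ⟨0, fun j _ => ⟨0, zero_mem _, map_zero _⟩⟩
  | add ξ₁ ξ₂ _ _ h₁ h₂ =>
    obtain ⟨J₁, h₁⟩ := h₁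
    obtain ⟨J₂, h₂⟩ := h₂
    refine ⟨max J₁ J₂, fun j hj => ?_⟩
    obtain ⟨η₁, h₃, rfl⟩ := h₁ j ((le_max_left _ _).trans hj)
    obtain ⟨η₂, h₄, h₅⟩ := h₂ j ((le_max_right _ _).trans hj)
    exact ⟨η₁ + η₂, add_mem h₃ h₄, by rw [map_add, h₅]⟩
  | smul c ξ _ h₁ =>
    obtain ⟨J, h₁⟩ := h₁
    refine ⟨J, fun j hj => ?_⟩
    obtain ⟨η, h₂, h₃⟩ := h₁ j hj
    exact ⟨c • η, Submodule.smul_mem _ c h₂, by rw [map_smul, h₃]⟩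

/-- Here $j$ depends on $\xi$ and is chosen after $N$, so the uniformity of $N$ in $j$ is essential.
-/
theorem AsymptoticallyIntertwined.norm_snd_le
    {t : toeplitzAlgebra (AffineSemigroup ℕ) × toeplitzAlgebra (AffineSemigroup ℤ)}
    (ht : AsymptoticallyIntertwined t) : ‖t.2‖ ≤ ‖t.1‖ := by
  obtain ⟨N, hN⟩ := ht 0
  refine opNorm_le_of_span_delta t.2.1 (norm_nonneg t.1) fun ξ hξ => ?_
  obtain ⟨J, hJ⟩ := exists_shiftedEmbedding_eq N hξ
  obtain ⟨η, hη, rfl⟩ := hJ J le_rfl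
  rw [← (hN η hη).2 J, LinearIsometry.norm_map, LinearIsometry.norm_map]
  exact t.1.1.le_opNorm η

theorem norm_boundaryMk_le (a : toeplitzAlgebra (AffineSemigroup ℕ)) : ‖boundaryMk a‖ ≤ ‖a‖ := by
  rw [BoundaryQuotient.norm_mk]
  simpa using Metric.infDist_le_dist_of_mem (x := a) (zero_mem boundaryIdeal)

theorem boundaryMk_sGen_mul_star : boundaryMk sGen * boundaryMk (star sGen) = 1 := by
  rw [← map_mul, ← map_one boundaryMk, eq_comm, boundaryMk_eq_iff]
  exact subset_closure (TwoSidedIdeal.subset_span rfl)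

theorem norm_sGen_pow_le (N : ℕ) : ‖sGen ^ N‖ ≤ 1 := by
  have h : ‖sGen‖ ≤ 1 := by
    refine ContinuousLinearMap.opNorm_le_bound _ zero_le_one fun ξ => ?_
    rw [one_mul]
    exact (norm_toeplitzOp_apply _ ξ).le
  induction N with
  | zero => rw [pow_zero]; exact ContinuousLinearMap.norm_id_le
  | succ n ih =>
    rw [pow_succ]
    exact (norm_mul_le _ _).trans (mul_le_one₀ ih (norm_nonneg _) h)

/-- Modulo the ideal $s^N(s^N)^*=1$, so $a$ and $as^N(s^N)^*$ have the same class. -/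
theorem norm_boundaryMk_le_mul_sGen_pow (a : toeplitzAlgebra (AffineSemigroup ℕ)) (N : ℕ) :
    ‖boundaryMk a‖ ≤ ‖a * sGen ^ N‖ := by
  have h : boundaryMk a = boundaryMk (a * sGen ^ N * star (sGen ^ N)) := by
    have hN : boundaryMk (sGen ^ N) * boundaryMk (star (sGen ^ N)) = 1 := by
      rw [star_pow, map_pow, map_pow]
      exact pow_mul_pow_eq_one N boundaryMk_sGen_mul_star
    rw [map_mul, map_mul, mul_assoc, hN, mul_one]
  rw [h]
  refine (norm_boundaryMk_le _).trans ((norm_mul_le _ _).trans ?_)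
  refine mul_le_of_le_one_right (norm_nonneg _) ?_
  exact (norm_star (sGen ^ N).1).le.trans (norm_sGen_pow_le N)

theorem sGen_pow_delta (N : ℕ) (z : AffineSemigroup ℕ) :
    (sGen ^ N).1 (delta z) = delta ⟨N + z.add, z.mul⟩ := by
  induction N with
  | zero => rw [pow_zero, zero_add]; rfl
  | succ n ih =>
    rw [pow_succ']
    change toeplitzOp ⟨1, 1⟩ ((sGen ^ n).1 (delta z)) = _
    rw [ih, toeplitzOp_delta]
    simp only [mul_def, Nat.cast_id, PNat.one_coe, one_mul]
    rw [← add_assoc, add_comm 1 n]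

theorem sGen_pow_mem_tailSpan (N : ℕ) {ξ : ellTwo (AffineSemigroup ℕ)}
    (hξ : ξ ∈ Submodule.span ℂ (Set.range (delta : AffineSemigroup ℕ → _))) :
    (sGen ^ N).1 ξ ∈ tailSpan N := by
  have h : Submodule.span ℂ (Set.range (delta : AffineSemigroup ℕ → _)) ≤
      (tailSpan N).comap (sGen ^ N).1.toLinearMap := by
    rw [Submodule.span_le]
    rintro _ ⟨z, rfl⟩
    change (sGen ^ N).1 (delta z) ∈ tailSpan N
    rw [sGen_pow_delta]
    exact delta_mem_tailSpan (Nat.le_add_right _ _)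
  exact h hξ

/-- The factor $s^N$ moves all finitely supported vectors into the tail, where $V_0$ alone suffices.
-/
theorem AsymptoticallyIntertwined.norm_boundaryMk_fst_le
    {t : toeplitzAlgebra (AffineSemigroup ℕ) × toeplitzAlgebra (AffineSemigroup ℤ)}
    (ht : AsymptoticallyIntertwined t) : ‖boundaryMk t.1‖ ≤ ‖t.2‖ := by
  obtain ⟨N, hN⟩ := ht 0
  refine (norm_boundaryMk_le_mul_sGen_pow t.1 N).trans ?_
  refine opNorm_le_of_span_delta (t.1 * sGen ^ N).1 (norm_nonneg t.2) fun ξ hξ => ?_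
  change ‖t.1.1 ((sGen ^ N).1 ξ)‖ ≤ _
  rw [← (shiftedEmbedding 0).norm_map, (hN _ (sGen_pow_mem_tailSpan N hξ)).2 0]
  refine (t.2.1.le_opNorm _).trans ?_
  rw [LinearIsometry.norm_map]
  refine mul_le_mul_of_nonneg_left ?_ (norm_nonneg _)
  exact ((sGen ^ N).1.le_opNorm ξ).trans
    (mul_le_of_le_one_left (norm_nonneg _) (norm_sGen_pow_le N))

/-! ### The algebra of pairs as the graph of a representation -/

/-- The C⋆-algebra generated by the pairs `(T_x, T_x)`. -/
noncomputable def pairAlgebra :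
    StarSubalgebra ℂ (toeplitzAlgebra (AffineSemigroup ℕ) × toeplitzAlgebra (AffineSemigroup ℤ)) :=
  (StarAlgebra.adjoin ℂ (Set.range fun x : AffineSemigroup ℕ =>
    (toeplitzGen x, toeplitzGen (inclusion x)))).topologicalClosure

instance isClosed_pairAlgebra : IsClosed (pairAlgebra : Set (toeplitzAlgebra (AffineSemigroup ℕ) ×
    toeplitzAlgebra (AffineSemigroup ℤ))) :=
  StarSubalgebra.isClosed_topologicalClosure _

theorem continuous_norm_boundaryMk : Continuous fun a => ‖boundaryMk a‖ := by
  simp only [BoundaryQuotient.norm_mk]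
  exact Metric.continuous_infDist_pt _

theorem norm_le_of_mem_pairAlgebra
    {t : toeplitzAlgebra (AffineSemigroup ℕ) × toeplitzAlgebra (AffineSemigroup ℤ)}
    (ht : t ∈ pairAlgebra) : ‖t.2‖ ≤ ‖t.1‖ ∧ ‖boundaryMk t.1‖ ≤ ‖t.2‖ := by
  have hcl : IsClosed {t : toeplitzAlgebra (AffineSemigroup ℕ) ×
      toeplitzAlgebra (AffineSemigroup ℤ) | ‖t.2‖ ≤ ‖t.1‖ ∧ ‖boundaryMk t.1‖ ≤ ‖t.2‖} :=
    .inter (isClosed_le continuous_snd.norm continuous_fst.norm)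
      (isClosed_le (continuous_norm_boundaryMk.comp continuous_fst) continuous_snd.norm)
  refine closure_minimal (fun u hu => ?_) hcl ht
  have hle : (StarAlgebra.adjoin ℂ (Set.range fun x : AffineSemigroup ℕ =>
      (toeplitzGen x, toeplitzGen (inclusion x)))).toSubalgebra ≤ asymptoticSubalgebra := by
    rw [StarAlgebra.adjoin_toSubalgebra, Algebra.adjoin_le_iff]
    rintro v (⟨x, rfl⟩ | ⟨x, hx⟩)
    · exact asymptoticallyIntertwined_gen x
    · rw [← star_star v, ← hx]
      exact asymptoticallyIntertwined_star_gen x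
  have hu' : AsymptoticallyIntertwined u := hle hu
  exact ⟨hu'.norm_snd_le, hu'.norm_boundaryMk_fst_le⟩

theorem gen_mem_pairAlgebra (x : AffineSemigroup ℕ) :
    (toeplitzGen x, toeplitzGen (inclusion x)) ∈ pairAlgebra :=
  StarSubalgebra.le_topologicalClosure _ (StarAlgebra.subset_adjoin ℂ _ ⟨x, rfl⟩)

/-- The first projection of `pairAlgebra`. -/
noncomputable def pairFst : pairAlgebra →⋆ₐ[ℂ] toeplitzAlgebra (AffineSemigroup ℕ) :=
  (StarAlgHom.fst ℂ _ _).comp pairAlgebra.subtype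

/-- The product carries the maximum norm, and the first coordinate dominates. -/
theorem isometry_pairFst : Isometry pairFst :=
  AddMonoidHomClass.isometry_of_norm pairFst fun t =>
    (max_eq_left (norm_le_of_mem_pairAlgebra t.2).1).symm

theorem pairFst_bijective : Function.Bijective pairFst :=
  ⟨isometry_pairFst.injective, surjective_of_toeplitzGen_mem_range pairFst
    isometry_pairFst.isClosedEmbedding.isClosed_range
    fun x => ⟨⟨_, gen_mem_pairAlgebra x⟩, rfl⟩⟩

/-- The representation of `𝒯(ℕ ⋊ ℕ^×)` in `𝒯(ℤ ⋊ ℕ^×)` with `T_x ↦ T_x`. -/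
noncomputable def toeplitzRep :
    toeplitzAlgebra (AffineSemigroup ℕ) →⋆ₐ[ℂ] toeplitzAlgebra (AffineSemigroup ℤ) :=
  ((StarAlgHom.snd ℂ _ _).comp pairAlgebra.subtype).comp
    ((StarAlgEquiv.ofBijective pairFst pairFst_bijective).symm : _ →⋆ₐ[ℂ] _)

theorem toeplitzRep_pairFst (t : pairAlgebra) : toeplitzRep (pairFst t) = t.1.2 := by
  have h : (StarAlgEquiv.ofBijective pairFst pairFst_bijective).symm (pairFst t) = t :=
    (StarAlgEquiv.ofBijective pairFst pairFst_bijective).symm_apply_apply t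
  exact congrArg (fun u : pairAlgebra => u.1.2) h

theorem toeplitzRep_gen (x : AffineSemigroup ℕ) :
    toeplitzRep (toeplitzGen x) = toeplitzGen (inclusion x) :=
  toeplitzRep_pairFst ⟨_, gen_mem_pairAlgebra x⟩

theorem norm_toeplitzRep_le (a : toeplitzAlgebra (AffineSemigroup ℕ)) :
    ‖toeplitzRep a‖ ≤ ‖a‖ := by
  obtain ⟨t, rfl⟩ := pairFst_bijective.2 a
  rw [toeplitzRep_pairFst]
  exact (norm_le_of_mem_pairAlgebra t.2).1

theorem norm_boundaryMk_le_toeplitzRep (a : toeplitzAlgebra (AffineSemigroup ℕ)) :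
    ‖boundaryMk a‖ ≤ ‖toeplitzRep a‖ := by
  obtain ⟨t, rfl⟩ := pairFst_bijective.2 a
  rw [toeplitzRep_pairFst]
  exact (norm_le_of_mem_pairAlgebra t.2).2

/-! ### Passage to the quotient -/

theorem star_toeplitzGen_of_mul_eq_one {M : Type*} [Monoid M] [IsLeftCancelMul M] {x y : M}
    (h : x * y = 1) : star (toeplitzGen x) = toeplitzGen y := by
  have h₁ : toeplitzGen x * toeplitzGen y = 1 := by
    rw [← toeplitzGen_mul, h]
    apply Subtype.ext
    change toeplitzOp (1 : M) = 1
    have h₂ := isometry_toeplitzGen (1 : M)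
    have h₃ : toeplitzGen (1 : M) * toeplitzGen 1 = toeplitzGen 1 := by
      rw [← toeplitzGen_mul, one_mul]
    have h₄ : toeplitzGen (1 : M) = 1 := by
      rw [← one_mul (toeplitzGen (1 : M)), ← h₂, mul_assoc, h₃]
    exact congrArg Subtype.val h₄
  calc star (toeplitzGen x) = star (toeplitzGen x) * (toeplitzGen x * toeplitzGen y) := by
        rw [h₁, mul_one]
    _ = toeplitzGen y := by rw [← mul_assoc, isometry_toeplitzGen, one_mul]

theorem toeplitzRep_eq_zero_of_mem {a : toeplitzAlgebra (AffineSemigroup ℕ)}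
    (ha : a ∈ boundaryIdeal) : toeplitzRep a = 0 := by
  have hcont : Continuous toeplitzRep := AddMonoidHomClass.continuous_of_bound toeplitzRep 1
    fun a => by simpa using norm_toeplitzRep_le a
  refine closure_minimal (fun b hb => ?_) (isClosed_singleton.preimage hcont) ha
  have hle : TwoSidedIdeal.span {1 - sGen * star sGen} ≤
      TwoSidedIdeal.ker (toeplitzRep : _ →+* toeplitzAlgebra (AffineSemigroup ℤ)) := by
    rw [TwoSidedIdeal.span_le]
    rintro _ rfl
    rw [SetLike.mem_coe, TwoSidedIdeal.mem_ker]
    change toeplitzRep (1 - sGen * star sGen) = 0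
    have h : (inclusion ⟨1, 1⟩ : AffineSemigroup ℤ) * ⟨-1, 1⟩ = 1 := rfl
    rw [map_sub, map_one, map_mul, map_star, sGen, toeplitzRep_gen,
      star_toeplitzGen_of_mul_eq_one h, ← toeplitzGen_mul, h, sub_eq_zero]
    have h' : (1 : AffineSemigroup ℤ) * 1 = 1 := rfl
    -- This is $T_1=1$: $1=T_1^*T_1=T_1T_1=T_1$.
    rw [← isometry_toeplitzGen 1, star_toeplitzGen_of_mul_eq_one h', ← toeplitzGen_mul, h']
  exact (TwoSidedIdeal.mem_ker _).1 (hle hb)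

/-- The missing inequality comes from evaluating the contraction `toeplitzRep` at $a-i$ for $i$ in
the ideal. -/
theorem norm_toeplitzRep (a : toeplitzAlgebra (AffineSemigroup ℕ)) :
    ‖toeplitzRep a‖ = ‖boundaryMk a‖ := by
  refine le_antisymm ?_ (norm_boundaryMk_le_toeplitzRep a)
  rw [BoundaryQuotient.norm_mk]
  refine (Metric.le_infDist ⟨0, zero_mem boundaryIdeal⟩).2 fun i hi => ?_
  rw [dist_eq_norm, ← sub_zero (toeplitzRep a), ← toeplitzRep_eq_zero_of_mem hi, ← map_sub]
  exact norm_toeplitzRep_le _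

/-- The homomorphism induced by `toeplitzRep` on the quotient by `⟨1 - s s⋆⟩`. -/
noncomputable def boundaryRep : BoundaryQuotient →⋆ₐ[ℂ] toeplitzAlgebra (AffineSemigroup ℤ) :=
  { Ideal.Quotient.liftₐ boundaryIdeal toeplitzRep.toAlgHom
      fun _ ha => toeplitzRep_eq_zero_of_mem ha with
    map_star' := fun b => by
      obtain ⟨a, rfl⟩ := boundaryMk_surjective b
      exact map_star toeplitzRep a }

theorem boundaryRep_boundaryMk (a : toeplitzAlgebra (AffineSemigroup ℕ)) :
    boundaryRep (boundaryMk a) = toeplitzRep a := rfl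

theorem norm_boundaryRep (b : BoundaryQuotient) : ‖boundaryRep b‖ = ‖b‖ := by
  obtain ⟨a, rfl⟩ := boundaryMk_surjective b
  rw [boundaryRep_boundaryMk, norm_toeplitzRep]

theorem boundaryRep_injective_and_isClosed_range :
    Function.Injective boundaryRep ∧ IsClosed (Set.range boundaryRep) := by
  let _ : NormedAddCommGroup BoundaryQuotient := Submodule.Quotient.normedAddCommGroup boundaryIdeal
  have : CompleteSpace BoundaryQuotient := Submodule.Quotient.completeSpace boundaryIdeal
  have h : Isometry boundaryRep := AddMonoidHomClass.isometry_of_norm boundaryRep norm_boundaryRep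
  exact ⟨h.injective, h.isClosedEmbedding.isClosed_range⟩

/-- $(m,k)=(m,1)(0,k)$, and $T_{(-n,1)}=T_{(n,1)}^*$ supplies the negative translations. -/
theorem toeplitzGen_mem_range_boundaryRep (x : AffineSemigroup ℤ) :
    toeplitzGen x ∈ boundaryRep.range := by
  have h (y : AffineSemigroup ℕ) : toeplitzGen (inclusion y) ∈ boundaryRep.range :=
    ⟨boundaryMk (toeplitzGen y), toeplitzRep_gen y⟩
  have hadd (m : ℤ) : toeplitzGen (⟨m, 1⟩ : AffineSemigroup ℤ) ∈ boundaryRep.range := by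
    obtain ⟨n, rfl | rfl⟩ := m.eq_nat_or_neg
    · exact h ⟨n, 1⟩
    · have hn : (inclusion ⟨n, 1⟩ : AffineSemigroup ℤ) * ⟨-n, 1⟩ = 1 := by
        rw [mul_def]
        apply AffineSemigroup.ext
        · change (n : ℤ) + ((1 : ℕ) : ℤ) * -n = 0
          simp
        · rfl
      rw [← star_toeplitzGen_of_mul_eq_one hn]
      exact star_mem (h _)
  have hx : x = ⟨x.add, 1⟩ * inclusion ⟨0, x.mul⟩ := by
    rw [mul_def]
    apply AffineSemigroup.ext
    · change x.add = x.add + ((1 : ℕ) : ℤ) * 0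
      simp
    · exact (one_mul _).symm
  rw [hx, toeplitzGen_mul]
  exact mul_mem (hadd _) (h _)

theorem boundaryRep_bijective : Function.Bijective boundaryRep :=
  ⟨boundaryRep_injective_and_isClosed_range.1, surjective_of_toeplitzGen_mem_range boundaryRep
    boundaryRep_injective_and_isClosed_range.2 toeplitzGen_mem_range_boundaryRep⟩

/-- The quotient map as a star homomorphism. -/
noncomputable def boundaryMkStar : toeplitzAlgebra (AffineSemigroup ℕ) →⋆ₐ[ℂ] BoundaryQuotient :=
  { boundaryMk with map_star' := fun _ => rfl }

theorem corollary1p5 :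
    ∃ Φ : BoundaryQuotient ≃⋆ₐ[ℂ] toeplitzAlgebra (AffineSemigroup ℤ),
      (∀ x : AffineSemigroup ℕ,
        Φ (boundaryMk (toeplitzGen x)) = toeplitzGen (AffineSemigroup.inclusion x)) ∧
      (∀ b : BoundaryQuotient, ‖Φ b‖ = ‖b‖) ∧
      (∀ Ψ : BoundaryQuotient →⋆ₐ[ℂ] toeplitzAlgebra (AffineSemigroup ℤ),
        (∀ x : AffineSemigroup ℕ,
          Ψ (boundaryMk (toeplitzGen x)) = toeplitzGen (AffineSemigroup.inclusion x)) →
        ∀ b : BoundaryQuotient, Ψ b = Φ b) := by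
  refine ⟨StarAlgEquiv.ofBijective boundaryRep boundaryRep_bijective, toeplitzRep_gen,
    norm_boundaryRep, fun Ψ hΨ b => ?_⟩
  obtain ⟨a, rfl⟩ := boundaryMk_surjective b
  -- $\Psi$ is not assumed continuous; its composite with the quotient map is a $*$-homomorphism of
  -- C$^*$-algebras, hence contractive.
  have h : Ψ.comp boundaryMkStar = toeplitzRep :=
    toeplitzAlgebra_hom_ext fun x => (hΨ x).trans (toeplitzRep_gen x).symm
  exact DFunLike.congr_fun h a
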